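/- Let $\kappa_l>0$, $c>0$ and $M,\mu_c,\sigma<\infty$ be given. There are constants $c_1,c_2,c_3,\kappa>0$, depending only on $(\kappa_l,c,M,\mu_c,\sigma)$, such that the following holds. **Setting.** Let $\mathbf X$ be a random vector in $\mathbb R^p$ with law $P$, $\vec{\mathbf X}=(1,\mathbf X^T)^T$, and $\gamma_0\in\mathbb R^{p+1}$. Neither $\mathbb E\,\mathbf X=0$ nor a zero intercept $\gamma_0(1)=0$ is required. Assume * $\lambda_{\min}\{\mathbb E(\vec{\mathbf X}\vec{\mathbf X}^T)\}\ge\kappa_l$; * $\sup_{\|v\|_2\le1}\{\mathbb E|\vec{\mathbf X}^Tv|^{2+c}\}^{1/(2+c)}\le M$; * $\{\mathbb E|\vec{\mathbf X}^T\gamma_0|^{c}\}^{1/c}\le\mu_c$; * $\max_{1\le j\le p+1}\|\vec{\mathbf X}(j)\|_{\psi_2}\le\sigma$, where $\|Z\|_{\psi_2}=\inf\{t>0:\mathbb E\exp(Z^2/t^2)\le2\}$. Let $(\mathbf X_i,R_i^*)_{i=1}^N$, $N\ge1$, be i.i.d., where $\mathbf X_i$ has law $P$, $R_i^*\in\{0,1\}$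 and $\mathbb P(R_i^*=1\mid\mathbf X_i)=g(\vec{\mathbf X}_i^T\gamma_0)$ with $g(u)=e^u/(1+e^u)$. Let $$\ell_N(\gamma)=-\frac1N\sum_{i=1}^N\left[R_i^*\vec{\mathbf X}_i^T\gamma-\log\{1+\exp(\vec{\mathbf X}_i^T\gamma)\}\right],\qquad \delta\ell(\Delta)=\ell_N(\gamma_0+\Delta)-\ell_N(\gamma_0)-\Delta^T\nabla\ell_N(\gamma_0).$$ **(i)** For all $p$ and $N$ and all such laws, coefficients and samples, with probability at least $1-2e^{-c_1N}$, $$\delta\ell(\Delta)\ \ge\ c_2\|\Delta\|_2\left\{\|\Delta\|_2-c_3\sqrt{\frac{\log(p+1)}{N}}\,\|\Delta\|_1\right\}\qquad\text{for all }\Delta\in\mathbb R^{p+1}\text{ with }\|\Delta\|_2\le1.$$ **(ii)** Let $p=p_N$ and $s=s_N$ be sequences of nonnegative integers with $s\log p=o(N)$ (with $\log 0:=0$). Then there is $N_0$ such that for every $N\ge N_0$ and every such law, coefficient and sample of size $N$ in dimension $p_N$ whose support $S=\{j:\gamma_0(j)\ne0\}$ has $s_N$ elements, with probability at least $1-2e^{-c_1N}$,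 $$\delta\ell(\Delta)\ \ge\ \kappa\|\Delta\|_2^2\qquad\text{for all }\Delta\in\mathbb R^{p+1}\text{ with }\|\Delta_{S^c}\|_1\le3\|\Delta_S\|_1\text{ and }\|\Delta\|_2\le1.$$ -/

import Mathlib

open MeasureTheory ProbabilityTheory Filter
open scoped ENNReal RealInnerProductSpace

universe u

namespace BalancedLogistic

/-- The covariate vector with an intercept, `(1, x) ∈ ℝ^(p+1)`. -/
noncomputable def withIntercept {p : ℕ} (x : EuclideanSpace ℝ (Fin p)) :
    EuclideanSpace ℝ (Fin (p + 1)) :=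
  WithLp.toLp 2 (Fin.cons (1 : ℝ) (fun j => x j) : Fin (p + 1) → ℝ)

/-- The `ℓ₁` norm of a vector. -/
noncomputable def l1Norm {d : ℕ} (v : EuclideanSpace ℝ (Fin d)) : ℝ :=
  ∑ j, |v j|

/-- The support `{j : v(j) ≠ 0}`. -/
noncomputable def supp {d : ℕ} (v : EuclideanSpace ℝ (Fin d)) : Finset (Fin d) :=
  Finset.univ.filter (fun j => v j ≠ 0)

/-- The sub-Gaussian (Orlicz) norm `inf {t > 0 : E exp(f² / t²) ≤ 2}`, equal to `∞` if there is no
such `t`. -/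
noncomputable def psi2Norm {α : Type*} [MeasurableSpace α] (f : α → ℝ) (P : Measure α) : ℝ≥0∞ :=
  ⨅ (t : ℝ) (_ : 0 < t) (_ : ∫⁻ a, ENNReal.ofReal (Real.exp ((f a) ^ 2 / t ^ 2)) ∂P ≤ 2),
    ENNReal.ofReal t

/-- The matrix `E[(1, X) (1, X)ᵀ]` for `X ∼ P`. -/
noncomputable def secondMoment {p : ℕ} (P : Measure (EuclideanSpace ℝ (Fin p))) :
    Matrix (Fin (p + 1)) (Fin (p + 1)) ℝ :=
  Matrix.of fun j k => ∫ x, withIntercept x j * withIntercept x k ∂P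

theorem secondMoment_isHermitian {p : ℕ} (P : Measure (EuclideanSpace ℝ (Fin p))) :
    (secondMoment P).IsHermitian := by
  ext j k
  simp [secondMoment, mul_comm]

/-- The smallest eigenvalue of a real symmetric matrix. -/
noncomputable def minEigenvalue {d : ℕ} {A : Matrix (Fin d) (Fin d) ℝ} (hA : A.IsHermitian) : ℝ :=
  ⨅ j, hA.eigenvalues j

/-- The negative average log-likelihood
`-N⁻¹ ∑ᵢ [rᵢ (1, xᵢ)ᵀγ - log {1 + exp((1, xᵢ)ᵀγ)}]` of the balanced logistic model. -/
noncomputable def loss {p N : ℕ} (x : Fin N → EuclideanSpace ℝ (Fin p)) (r : Fin N → ℝ)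
    (γ : EuclideanSpace ℝ (Fin (p + 1))) : ℝ :=
  -((N : ℝ)⁻¹ * ∑ i, (r i * ⟪withIntercept (x i), γ⟫
    - Real.log (1 + Real.exp ⟪withIntercept (x i), γ⟫)))

/-- The first-order Taylor remainder of the loss at `γ` in the direction `Δ`. -/
noncomputable def deltaLoss {p N : ℕ} (x : Fin N → EuclideanSpace ℝ (Fin p)) (r : Fin N → ℝ)
    (Δ γ : EuclideanSpace ℝ (Fin (p + 1))) : ℝ :=
  loss x r (γ + Δ) - loss x r γ - ⟪Δ, gradient (loss x r) γ⟫

/-- The set of `Δ` with `‖Δ_{Sᶜ}‖₁ ≤ 3 ‖Δ_S‖₁` and `‖Δ‖₂ ≤ 1`. -/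
def cone {d : ℕ} (S : Finset (Fin d)) : Set (EuclideanSpace ℝ (Fin d)) :=
  {Δ | ∑ j ∈ Sᶜ, |Δ j| ≤ 3 * ∑ j ∈ S, |Δ j| ∧ ‖Δ‖ ≤ 1}

/-- Restricted strong convexity with parameter `κ` on the set `A`. -/
def RSC {p N : ℕ} (x : Fin N → EuclideanSpace ℝ (Fin p)) (r : Fin N → ℝ)
    (γ : EuclideanSpace ℝ (Fin (p + 1))) (κ : ℝ) (A : Set (EuclideanSpace ℝ (Fin (p + 1)))) :
    Prop :=
  ∀ Δ ∈ A, κ * ‖Δ‖ ^ 2 ≤ deltaLoss x r Δ γ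

/-- The conditions on the law `P` of the covariates and on the coefficient `γ₀`. -/
structure DesignConditions {p : ℕ} (P : Measure (EuclideanSpace ℝ (Fin p)))
    (γ₀ : EuclideanSpace ℝ (Fin (p + 1))) (κl c M μc σ : ℝ) : Prop where
  min_eigenvalue : κl ≤ minEigenvalue (secondMoment_isHermitian P)
  moment : ∀ v : EuclideanSpace ℝ (Fin (p + 1)), ‖v‖ ≤ 1 →
    eLpNorm (fun x => ⟪withIntercept x, v⟫) (ENNReal.ofReal (2 + c)) P ≤ ENNReal.ofReal M
  moment_index :
    eLpNorm (fun x => ⟪withIntercept x, γ₀⟫) (ENNReal.ofReal c) P ≤ ENNReal.ofReal μc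
  marginal_subGaussian : ∀ j : Fin (p + 1),
    psi2Norm (fun x => withIntercept x j) P ≤ ENNReal.ofReal σ

/-- `(Xᵢ, Rᵢ)`, `i = 1, …, N`, are i.i.d., `Xᵢ` has law `P`, `Rᵢ ∈ {0, 1}` and
`P(Rᵢ = 1 | Xᵢ) = g((1, Xᵢ)ᵀγ₀)` with the logistic function `g`. -/
structure IsSample {Ω : Type*} [MeasurableSpace Ω] (μ : Measure Ω) {p N : ℕ}
    (P : Measure (EuclideanSpace ℝ (Fin p))) (γ₀ : EuclideanSpace ℝ (Fin (p + 1)))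
    (X : Fin N → Ω → EuclideanSpace ℝ (Fin p)) (R : Fin N → Ω → ℝ) : Prop where
  measurable_X : ∀ i, Measurable (X i)
  measurable_R : ∀ i, Measurable (R i)
  law_X : ∀ i, μ.map (X i) = P
  indep : iIndepFun (fun i ω => (X i ω, R i ω)) μ
  binary : ∀ i, ∀ᵐ ω ∂μ, R i ω = 0 ∨ R i ω = 1
  cond_prob : ∀ i, μ[R i | MeasurableSpace.comap (X i) inferInstance] =ᵐ[μ]
    fun ω => Real.sigmoid ⟪withIntercept (X i ω), γ₀⟫

end BalancedLogistic

/-! The responses cancel from the Taylor remainder, which is an average of nonnegative scalar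
remainders of `u ↦ log (1 + exp u)`, each at least a constant times `d ^ 2` while `u` and `d` stay
bounded. For a unit vector `v` it therefore suffices that a fixed fraction of the sample has bounded
index and `|⟪withIntercept x, v⟫|` in a fixed band `[α, β]`. A shorter vector in the same direction
is then covered by the same points, so no peeling over norms is needed.

For a single `v` the band has probability bounded below: the second moment is at least `κl`, and the
`2 + c` and `c` moments control what the truncations lose (`exists_small_ball_constants`).
Hoeffding's inequality turns this into a count, up to an error exponentially small in `N`.

Uniformity over `v` in an `ℓ₁` ball of radius `K` comes from Maurey's sparsification
(`exists_average_signedVertex_near`). Such a `v` is close, in the Euclidean and the empirical norm,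
to an average of `m` vertices `±K eⱼ`. There are only `(2 (p + 1)) ^ m` averages, so a union bound
is affordable for `m` of order `N / log (p + 1)`. The approximation then allows `K` of order `√(N /
log (p + 1))`, which is the `ℓ₁` term of (i). On the cone the `ℓ₁` norm is at most `4 √|S| ‖Δ‖`, and
(ii) follows. -/

namespace BalancedLogistic

/-! ### Local strong convexity of the logistic loss -/

section Curvature

/-- The first-order Taylor remainder of `u ↦ log (1 + exp u)`. -/
noncomputable def logisticRemainder (u d : ℝ) : ℝ :=
  Real.log (1 + Real.exp (u + d)) - Real.log (1 + Real.exp u) - d * Real.sigmoid u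

theorem hasDerivAt_log_one_add_exp (u : ℝ) :
    HasDerivAt (fun x => Real.log (1 + Real.exp x)) (Real.sigmoid u) u := by
  have h := ((Real.hasDerivAt_exp u).const_add 1).log (by positivity)
  convert h using 1
  rw [Real.sigmoid_def, Real.exp_neg]
  field_simp
  ring

/-- On `[-A, A]` the second derivative `sigmoid x * sigmoid (-x)` is at least `k = sigmoid (-A) ^
2`. Subtracting `k / 2 * x ^ 2` thus leaves a convex function, which lies above its tangent at `u`.
-/
theorem mul_sq_le_logisticRemainder {A u d : ℝ} (h : |u| + |d| ≤ A) :
    Real.sigmoid (-A) ^ 2 / 2 * d ^ 2 ≤ logisticRemainder u d := by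
  set k := Real.sigmoid (-A) ^ 2 with hk
  have hderiv : ∀ x, HasDerivAt (fun x => Real.log (1 + Real.exp x) - k / 2 * x ^ 2)
      (Real.sigmoid x - k * x) x := fun x => by
    have h2 := (hasDerivAt_log_one_add_exp x).sub (((hasDerivAt_id x).pow 2).const_mul (k / 2))
    refine h2.congr_deriv ?_
    simp only [id, Nat.cast_ofNat]
    ring
  have hmono : MonotoneOn (fun x => Real.sigmoid x - k * x) (Set.Icc (-A) A) := by
    have hd : ∀ x, HasDerivAt (fun x => Real.sigmoid x - k * x)
        (Real.sigmoid x * (1 - Real.sigmoid x) - k) x := fun x => by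
      refine ((Real.hasDerivAt_sigmoid x).fun_sub ((hasDerivAt_id x).const_mul k)).congr_deriv ?_
      ring
    refine monotoneOn_of_deriv_nonneg (convex_Icc _ _)
      (fun x _ => (hd x).continuousAt.continuousWithinAt)
      (fun x _ => (hd x).differentiableAt.differentiableWithinAt) fun x hx => ?_
    rw [interior_Icc] at hx
    rw [(hd x).deriv, ← Real.sigmoid_neg, hk, sq, sub_nonneg]
    exact mul_le_mul (Real.sigmoid_le hx.1.le) (Real.sigmoid_le (by linarith [hx.2]))
      (Real.sigmoid_nonneg _) (Real.sigmoid_nonneg _)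
  have hconv : ConvexOn ℝ (Set.Icc (-A) A)
      (fun x => Real.log (1 + Real.exp x) - k / 2 * x ^ 2) := by
    refine MonotoneOn.convexOn_of_deriv (convex_Icc _ _)
      (fun x _ => (hderiv x).continuousAt.continuousWithinAt)
      (fun x _ => (hderiv x).differentiableAt.differentiableWithinAt) ?_
    intro x hx y hy hxy
    rw [(hderiv x).deriv, (hderiv y).deriv]
    exact hmono (interior_subset hx) (interior_subset hy) hxy
  have hu : u ∈ Set.Icc (-A) A := by
    rw [Set.mem_Icc, ← abs_le]; linarith [abs_nonneg d]
  have hud : u + d ∈ Set.Icc (-A) A := by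
    rw [Set.mem_Icc, ← abs_le]; linarith [abs_add_le u d]
  rcases lt_trichotomy d 0 with hd | rfl | hd
  · have := hconv.slope_le_of_hasDerivAt hud hu (by linarith) (hderiv u)
    rw [slope_def_field, div_le_iff₀ (by linarith)] at this
    unfold logisticRemainder
    linarith
  · simp [logisticRemainder]
  · have := hconv.le_slope_of_hasDerivAt hu hud (by linarith) (hderiv u)
    rw [slope_def_field, le_div_iff₀ (by linarith)] at this
    unfold logisticRemainder
    linarith

theorem logisticRemainder_nonneg (u d : ℝ) : 0 ≤ logisticRemainder u d :=
  le_trans (by positivity) (mul_sq_le_logisticRemainder (le_refl (|u| + |d|)))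

theorem deltaLoss_eq_sum {p N : ℕ} (x : Fin N → EuclideanSpace ℝ (Fin p)) (r : Fin N → ℝ)
    (Δ γ : EuclideanSpace ℝ (Fin (p + 1))) :
    deltaLoss x r Δ γ =
      (N : ℝ)⁻¹ * ∑ i, logisticRemainder ⟪withIntercept (x i), γ⟫ ⟪withIntercept (x i), Δ⟫ := by
  have hin : ∀ i, HasFDerivAt (fun γ => ⟪withIntercept (x i), γ⟫)
      (innerSL ℝ (withIntercept (x i))) γ := fun i => (innerSL ℝ (withIntercept (x i))).hasFDerivAt
  have h : HasFDerivAt (loss x r)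
      (-((N : ℝ)⁻¹ • ∑ i, (r i • innerSL ℝ (withIntercept (x i))
        - Real.sigmoid ⟪withIntercept (x i), γ⟫ • innerSL ℝ (withIntercept (x i))))) γ := by
    unfold loss
    refine HasFDerivAt.neg (HasFDerivAt.const_mul (HasFDerivAt.fun_sum fun i _ => ?_) _)
    exact ((hin i).const_mul (r i)).sub
      ((hasDerivAt_log_one_add_exp ⟪withIntercept (x i), γ⟫).comp_hasFDerivAt γ (hin i))
  have hg : ⟪Δ, gradient (loss x r) γ⟫ =
      -((N : ℝ)⁻¹ * ∑ i, (r i * ⟪withIntercept (x i), Δ⟫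
        - Real.sigmoid ⟪withIntercept (x i), γ⟫ * ⟪withIntercept (x i), Δ⟫)) := by
    rw [real_inner_comm, gradient, InnerProductSpace.toDual_symm_apply, h.fderiv]
    simp
  rw [deltaLoss, hg]
  unfold loss
  rw [show ∀ a b c n : ℝ, -(n * a) - -(n * b) - -(n * c) = n * (b + c - a) from
    fun _ _ _ _ => by ring, ← Finset.sum_add_distrib, ← Finset.sum_sub_distrib]
  congr 1
  refine Finset.sum_congr rfl fun i _ => ?_
  rw [inner_add_right, logisticRemainder]
  ring

/-- Terms outside `s` are nonnegative and can be dropped. Since `ρ ≤ 1`, shrinking `v` keeps the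
increments below `β`, so the curvature constant does not depend on `ρ`. -/
theorem deltaLoss_smul_ge {p N : ℕ} (x : Fin N → EuclideanSpace ℝ (Fin p)) (r : Fin N → ℝ)
    (v γ : EuclideanSpace ℝ (Fin (p + 1))) {T α β q ρ : ℝ} (hα : 0 ≤ α)
    (hρ0 : 0 ≤ ρ) (hρ1 : ρ ≤ 1) (hN : 0 < N) {s : Finset (Fin N)} (hs : q * N ≤ s.card)
    (hsx : ∀ i ∈ s, |⟪withIntercept (x i), γ⟫| ≤ T ∧
      α ≤ |⟪withIntercept (x i), v⟫| ∧ |⟪withIntercept (x i), v⟫| ≤ β) :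
    Real.sigmoid (-(T + β)) ^ 2 / 2 * α ^ 2 * q * ρ ^ 2 ≤ deltaLoss x r (ρ • v) γ := by
  have hN' : (0 : ℝ) < N := by exact_mod_cast hN
  rw [deltaLoss_eq_sum, inv_mul_eq_div, le_div_iff₀ hN']
  have hterm : ∀ i ∈ s, Real.sigmoid (-(T + β)) ^ 2 / 2 * α ^ 2 * ρ ^ 2 ≤
      logisticRemainder ⟪withIntercept (x i), γ⟫ ⟪withIntercept (x i), ρ • v⟫ := by
    intro i hi
    obtain ⟨h1, h2, h3⟩ := hsx i hi
    rw [real_inner_smul_right]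
    set y := ⟪withIntercept (x i), v⟫
    refine le_trans ?_ (mul_sq_le_logisticRemainder (A := T + β) ?_)
    · rw [mul_pow, mul_assoc, mul_comm (ρ ^ 2), ← sq_abs y]
      gcongr
    · rw [abs_mul, abs_of_nonneg hρ0]
      nlinarith [abs_nonneg y]
  calc _ = Real.sigmoid (-(T + β)) ^ 2 / 2 * α ^ 2 * ρ ^ 2 * (q * N) := by ring
    _ ≤ Real.sigmoid (-(T + β)) ^ 2 / 2 * α ^ 2 * ρ ^ 2 * s.card := by gcongr
    _ = ∑ i ∈ s, Real.sigmoid (-(T + β)) ^ 2 / 2 * α ^ 2 * ρ ^ 2 := by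
      rw [Finset.sum_const, nsmul_eq_mul]; ring
    _ ≤ ∑ i ∈ s, logisticRemainder ⟪withIntercept (x i), γ⟫ ⟪withIntercept (x i), ρ • v⟫ :=
      Finset.sum_le_sum hterm
    _ ≤ _ := Finset.sum_le_sum_of_subset_of_nonneg (Finset.subset_univ _)
      fun i _ _ => logisticRemainder_nonneg _ _

end Curvature

/-! ### Maurey sparsification of the `ℓ₁` ball -/

section Sparsification

/-- The vertices `±K eⱼ` of the `ℓ₁` ball of radius `K`. -/
noncomputable def signedVertex {d : ℕ} (K : ℝ) (t : Fin d × Bool) : EuclideanSpace ℝ (Fin d) :=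
  (if t.2 then K else -K) • EuclideanSpace.single t.1 (1 : ℝ)

theorem exists_signedVertex_le {d : ℕ} [NeZero d] {K : ℝ} {v : EuclideanSpace ℝ (Fin d)}
    (hv : l1Norm v ≤ K) (φ : EuclideanSpace ℝ (Fin d) →ₗ[ℝ] ℝ) :
    ∃ t, φ (signedVertex K t) ≤ φ v := by
  obtain ⟨j, -, hj⟩ := Finset.exists_max_image Finset.univ
    (fun j => |φ (EuclideanSpace.single j (1 : ℝ))|) Finset.univ_nonempty
  have hsum : φ v = ∑ k, v k * φ (EuclideanSpace.single k (1 : ℝ)) := by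
    conv_lhs => rw [← (EuclideanSpace.basisFun (Fin d) ℝ).sum_repr v]
    simp
  have hlow : -(K * |φ (EuclideanSpace.single j (1 : ℝ))|) ≤ φ v := by
    have : |φ v| ≤ K * |φ (EuclideanSpace.single j (1 : ℝ))| := by
      rw [hsum]
      refine (Finset.abs_sum_le_sum_abs _ _).trans ?_
      refine le_trans ?_ (mul_le_mul_of_nonneg_right hv (abs_nonneg _))
      rw [l1Norm, Finset.sum_mul]
      refine Finset.sum_le_sum fun k _ => ?_
      rw [abs_mul]
      exact mul_le_mul_of_nonneg_left (hj k (Finset.mem_univ _)) (abs_nonneg _)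
    exact neg_le_of_abs_le this
  rcases le_total 0 (φ (EuclideanSpace.single j (1 : ℝ))) with h | h
  · refine ⟨(j, false), ?_⟩
    rw [abs_of_nonneg h] at hlow
    simpa [signedVertex] using hlow
  · refine ⟨(j, true), ?_⟩
    rw [abs_of_nonpos h] at hlow
    simpa [signedVertex] using hlow

/-- Maurey's empirical method, with the averaging replaced by a greedy choice. -/
theorem exists_sum_signedVertex_near {d : ℕ} [NeZero d] {H : Type*} [NormedAddCommGroup H]
    [InnerProductSpace ℝ H] (A : EuclideanSpace ℝ (Fin d) →ₗ[ℝ] H) {K b : ℝ}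
    (hA : ∀ j, ‖A (EuclideanSpace.single j 1)‖ ^ 2 ≤ b) {v : EuclideanSpace ℝ (Fin d)}
    (hv : l1Norm v ≤ K) (m : ℕ) :
    ∃ t : Fin m → Fin d × Bool,
      ‖A (∑ k, signedVertex K (t k) - (m : ℝ) • v)‖ ^ 2 ≤ m * (K ^ 2 * b) := by
  induction m with
  | zero => exact ⟨Fin.elim0, by simp⟩
  | succ m ih =>
    obtain ⟨t, ht⟩ := ih
    set S := A (∑ k, signedVertex K (t k) - (m : ℝ) • v) with hS
    -- The new vertex correlates with `S - A v` no more than `v` does. The cross term is then at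
    -- most that of `‖(S - A v) + A v‖ ^ 2 = ‖S‖ ^ 2`, and the squared error grows by at most `K ^ 2
    -- * b`.
    obtain ⟨w, hw⟩ := exists_signedVertex_le hv
      ((innerSL ℝ (S - A v)).toLinearMap ∘ₗ A)
    refine ⟨Fin.snoc t w, ?_⟩
    have hsplit : A (∑ k, signedVertex K ((Fin.snoc t w : Fin (m + 1) → Fin d × Bool) k)
        - ((m + 1 : ℕ) : ℝ) • v) = (S - A v) + A (signedVertex K w) := by
      rw [Fin.sum_univ_castSucc, hS]
      simp only [Fin.snoc_castSucc, Fin.snoc_last, ← map_sub, ← map_add]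
      congr 1
      push_cast
      module
    have hw' : ‖A (signedVertex K w)‖ ^ 2 ≤ K ^ 2 * b := by
      rw [signedVertex, map_smul, norm_smul, mul_pow]
      have : ‖(if w.2 then K else -K)‖ ^ 2 = K ^ 2 := by
        split_ifs <;> simp
      rw [this]
      gcongr
      exact hA _
    have hin : ⟪S - A v, A (signedVertex K w)⟫ ≤ ⟪S - A v, A v⟫ := hw
    rw [hsplit, norm_add_sq_real]
    have h2 : ‖S‖ ^ 2 = ‖S - A v‖ ^ 2 + 2 * ⟪S - A v, A v⟫ + ‖A v‖ ^ 2 := by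
      rw [← norm_add_sq_real, sub_add_cancel]
    push_cast
    nlinarith [sq_nonneg ‖A v‖]

/-- A vector of the `ℓ₁` ball of radius `K` is approximated by averages of `m` vertices, both in
the Euclidean norm and in the empirical norm of a design whose columns are bounded. -/
theorem exists_average_signedVertex_near {d N m : ℕ} [NeZero d] (hm : 0 < m)
    (a : Fin N → EuclideanSpace ℝ (Fin d)) {K B : ℝ} (ha : ∀ j, ∑ i, (a i j) ^ 2 ≤ B * N)
    {v : EuclideanSpace ℝ (Fin d)} (hv : l1Norm v ≤ K) :
    ∃ t : Fin m → Fin d × Bool,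
      (∑ i, ⟪a i, (m : ℝ)⁻¹ • ∑ k, signedVertex K (t k) - v⟫ ^ 2)
        + N * ‖(m : ℝ)⁻¹ • ∑ k, signedVertex K (t k) - v‖ ^ 2 ≤ N * (K ^ 2 * (B + 1) / m) := by
  have hm' : (0 : ℝ) < m := by exact_mod_cast hm
  -- Stacking the design on `√N` times the identity lets one greedy choice control both errors.
  let A : EuclideanSpace ℝ (Fin d) →ₗ[ℝ] EuclideanSpace ℝ (Fin N ⊕ Fin d) :=
    (WithLp.linearEquiv 2 ℝ (Fin N ⊕ Fin d → ℝ)).symm.toLinearMap ∘ₗ LinearMap.pi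
      (Sum.elim (fun i => (innerSL ℝ (a i)).toLinearMap)
        (fun j => √N • (innerSL ℝ (EuclideanSpace.single j (1 : ℝ))).toLinearMap))
  have hA : ∀ z, ‖A z‖ ^ 2 = (∑ i, ⟪a i, z⟫ ^ 2) + N * ‖z‖ ^ 2 := fun z => by
    rw [EuclideanSpace.real_norm_sq_eq, EuclideanSpace.real_norm_sq_eq, Fintype.sum_sum_type,
      Finset.mul_sum]
    simp [A, mul_pow, EuclideanSpace.inner_single_left]
  obtain ⟨t, ht⟩ := exists_sum_signedVertex_near A (K := K) (b := N * (B + 1)) (v := v)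
    (fun j => by
      rw [hA]
      have := ha j
      simp only [EuclideanSpace.inner_single_right]
      simp
      linarith) hv m
  refine ⟨t, ?_⟩
  have hscale : ∑ k, signedVertex K (t k) - (m : ℝ) • v =
      (m : ℝ) • ((m : ℝ)⁻¹ • ∑ k, signedVertex K (t k) - v) := by
    rw [smul_sub, smul_inv_smul₀ hm'.ne']
  rw [hscale, map_smul, norm_smul, mul_pow, hA, Real.norm_of_nonneg hm'.le] at ht
  rw [← mul_div_assoc, le_div_iff₀ hm']
  refine le_of_mul_le_mul_left ?_ hm'
  linarith

end Sparsification

/-! ### Small-ball probability from moments -/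

section SmallBall

theorem integral_abs_rpow_le_of_eLpNorm_le {α : Type*} [MeasurableSpace α] {P : Measure α}
    {f : α → ℝ} (hf : Measurable f) {q M : ℝ} (hq : 0 < q) (hM : 0 ≤ M)
    (h : eLpNorm f (ENNReal.ofReal q) P ≤ ENNReal.ofReal M) :
    Integrable (fun x => |f x| ^ q) P ∧ ∫ x, |f x| ^ q ∂P ≤ M ^ q := by
  have hq0 : ENNReal.ofReal q ≠ 0 := by simpa using hq
  have hmem : MemLp f (ENNReal.ofReal q) P :=
    ⟨hf.aestronglyMeasurable, h.trans_lt ENNReal.ofReal_lt_top⟩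
  have hint := hmem.integrable_norm_rpow hq0 ENNReal.ofReal_ne_top
  rw [ENNReal.toReal_ofReal hq.le] at hint
  refine ⟨hint, ?_⟩
  rw [hmem.eLpNorm_eq_integral_rpow_norm hq0 ENNReal.ofReal_ne_top,
    ENNReal.toReal_ofReal hq.le, ENNReal.ofReal_le_ofReal_iff hM] at h
  have hnn : 0 ≤ ∫ x, |f x| ^ q ∂P := integral_nonneg fun x => by positivity
  exact (Real.rpow_inv_le_iff_of_pos hnn hM hq).1 h

/-- A random variable with a lower bound on its second moment and an upper bound on a higher
moment lies in `[α, β]` in absolute value with a probability bounded from below, also on the event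
that another variable is bounded. -/
theorem le_add_sq_mul_measureReal_of_moments {α : Type*} [MeasurableSpace α] {P : Measure α}
    [IsProbabilityMeasure P] {Y u : α → ℝ} (hY : Measurable Y) (hu : Measurable u)
    {c M μc a β T : ℝ} (hc : 0 < c) (hM : 0 ≤ M) (hμ : 0 ≤ μc) (hβ : 0 < β)
    (hT : 0 < T) (hYM : eLpNorm Y (ENNReal.ofReal (2 + c)) P ≤ ENNReal.ofReal M)
    (huM : eLpNorm u (ENNReal.ofReal c) P ≤ ENNReal.ofReal μc) :
    ∫ x, Y x ^ 2 ∂P ≤ a ^ 2 + M ^ (2 + c) / β ^ c + β ^ 2 * (μc ^ c / T ^ c)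
      + β ^ 2 * P.real {x | |u x| ≤ T ∧ a ≤ |Y x| ∧ |Y x| ≤ β} := by
  obtain ⟨hi1, hb1⟩ := integral_abs_rpow_le_of_eLpNorm_le hY (by linarith) hM hYM
  obtain ⟨hi2, hb2⟩ := integral_abs_rpow_le_of_eLpNorm_le hu hc hμ huM
  set G := {x | |u x| ≤ T ∧ a ≤ |Y x| ∧ |Y x| ≤ β} with hG
  have hGm : MeasurableSet G :=
    (measurableSet_le hu.abs measurable_const).inter
      ((measurableSet_le measurable_const hY.abs).inter
        (measurableSet_le hY.abs measurable_const))
  have hi3 : Integrable (G.indicator (fun _ => (1 : ℝ))) P :=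
    (integrable_const 1).indicator hGm
  -- One summand for each case: `|Y| < a`, `|Y| > β`, `|u| > T` with `|Y| ≤ β`, and membership in
  -- `G`.
  have hpt : ∀ x, Y x ^ 2 ≤ a ^ 2 + |Y x| ^ (2 + c) / β ^ c + β ^ 2 * (|u x| ^ c / T ^ c)
      + β ^ 2 * G.indicator (fun _ => (1 : ℝ)) x := by
    intro x
    have n1 : 0 ≤ |Y x| ^ (2 + c) / β ^ c := by positivity
    have n2 : 0 ≤ β ^ 2 * (|u x| ^ c / T ^ c) := by positivity
    have n3 : 0 ≤ β ^ 2 * G.indicator (fun _ => (1 : ℝ)) x :=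
      mul_nonneg (sq_nonneg _) (Set.indicator_nonneg (fun _ _ => zero_le_one) _)
    have n4 := sq_nonneg a
    rw [← sq_abs (Y x)]
    rcases lt_or_ge |Y x| a with h1 | h1
    · have : |Y x| ^ 2 ≤ a ^ 2 := by gcongr
      linarith
    rcases lt_or_ge β |Y x| with h2 | h2
    · have : |Y x| ^ 2 ≤ |Y x| ^ (2 + c) / β ^ c := by
        have hpos : 0 < |Y x| := hβ.trans h2
        rw [le_div_iff₀ (by positivity), Real.rpow_add hpos]
        norm_cast
        gcongr
      linarith
    have h3 : |Y x| ^ 2 ≤ β ^ 2 := by gcongr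
    rcases lt_or_ge T |u x| with h4 | h4
    · have : 1 ≤ |u x| ^ c / T ^ c := by
        rw [le_div_iff₀ (by positivity), one_mul]
        gcongr
      nlinarith [sq_nonneg β]
    · have : G.indicator (fun _ => (1 : ℝ)) x = 1 :=
        Set.indicator_of_mem (show x ∈ G from ⟨h4, h1, h2⟩) _
      rw [this] at n3 ⊢
      linarith
  have hI1 : Integrable (fun x => a ^ 2 + |Y x| ^ (2 + c) / β ^ c) P :=
    (integrable_const _).add (hi1.div_const _)
  have hI2 : Integrable (fun x => β ^ 2 * (|u x| ^ c / T ^ c)) P :=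
    (hi2.div_const _).const_mul _
  have hI3 : Integrable (fun x => β ^ 2 * G.indicator (fun _ => (1 : ℝ)) x) P :=
    hi3.const_mul _
  calc ∫ x, Y x ^ 2 ∂P
      ≤ ∫ x, (a ^ 2 + |Y x| ^ (2 + c) / β ^ c + β ^ 2 * (|u x| ^ c / T ^ c)
          + β ^ 2 * G.indicator (fun _ => (1 : ℝ)) x) ∂P :=
        integral_mono_of_nonneg (Eventually.of_forall fun x => sq_nonneg _)
          ((hI1.add hI2).add hI3) (Eventually.of_forall hpt)
    _ = a ^ 2 + (∫ x, |Y x| ^ (2 + c) ∂P) / β ^ c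
          + β ^ 2 * ((∫ x, |u x| ^ c ∂P) / T ^ c) + β ^ 2 * P.real G := by
        rw [integral_add (by exact hI1.add hI2) hI3, integral_add hI1 hI2,
          integral_add (integrable_const _) (hi1.div_const _), integral_const_mul,
          integral_const_mul, integral_div, integral_div, integral_indicator_const _ hGm]
        simp
    _ ≤ _ := by gcongr

theorem measurable_withIntercept {p : ℕ} :
    Measurable (withIntercept : EuclideanSpace ℝ (Fin p) → EuclideanSpace ℝ (Fin (p + 1))) := by
  refine (WithLp.measurable_toLp 2 _).comp (measurable_pi_lambda _ fun j => ?_)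
  refine Fin.cases ?_ (fun j => ?_) j
  · exact measurable_const
  · simp only [Fin.cons_succ]
    fun_prop

theorem measurable_inner_withIntercept {p : ℕ} (v : EuclideanSpace ℝ (Fin (p + 1))) :
    Measurable fun x : EuclideanSpace ℝ (Fin p) => ⟪withIntercept x, v⟫ :=
  measurable_withIntercept.inner measurable_const

theorem minEigenvalue_mul_norm_sq_le {d : ℕ} {A : Matrix (Fin d) (Fin d) ℝ} (hA : A.IsHermitian)
    (v : EuclideanSpace ℝ (Fin d)) :
    minEigenvalue hA * ‖v‖ ^ 2 ≤ ∑ j, ∑ k, v j * v k * A j k := by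
  have hform : ∑ j, ∑ k, v j * v k * A j k = ⟪v, A.toEuclideanLin v⟫ := by
    simp only [PiLp.inner_apply, Matrix.toLpLin_apply, Matrix.mulVec, dotProduct]
    simp only [RCLike.inner_apply, conj_trivial, Finset.sum_mul]
    exact Finset.sum_congr rfl fun j _ => Finset.sum_congr rfl fun k _ => by ring
  rw [hform, ← hA.eigenvectorBasis.sum_inner_mul_inner, ← real_inner_self_eq_norm_sq,
    ← hA.eigenvectorBasis.sum_inner_mul_inner v v, Finset.mul_sum]
  refine Finset.sum_le_sum fun j _ => ?_
  have hsymm : ⟪hA.eigenvectorBasis j, A.toEuclideanLin v⟫ =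
      hA.eigenvalues j * ⟪hA.eigenvectorBasis j, v⟫ := by
    have h1 := (Matrix.isSymmetric_toEuclideanLin_iff.2 hA) (hA.eigenvectorBasis j) v
    rw [← h1]
    have h2 : A.toEuclideanLin (hA.eigenvectorBasis j) =
        hA.eigenvalues j • hA.eigenvectorBasis j := by
      rw [Matrix.toLpLin_apply, hA.mulVec_eigenvectorBasis]
      rfl
    rw [h2, real_inner_smul_left]
  rw [hsymm, real_inner_comm v]
  have : minEigenvalue hA ≤ hA.eigenvalues j := ciInf_le (Set.finite_range _).bddBelow j
  nlinarith [mul_self_nonneg ⟪hA.eigenvectorBasis j, v⟫]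

theorem DesignConditions.le_integral_sq {p : ℕ} {P : Measure (EuclideanSpace ℝ (Fin p))}
    [IsProbabilityMeasure P] {γ₀ : EuclideanSpace ℝ (Fin (p + 1))} {κl c M μc σ : ℝ} (hc : 0 < c)
    (h : DesignConditions P γ₀ κl c M μc σ) (v : EuclideanSpace ℝ (Fin (p + 1))) :
    κl * ‖v‖ ^ 2 ≤ ∫ x, ⟪withIntercept x, v⟫ ^ 2 ∂P := by
  have hmem : ∀ j, MemLp (fun x => withIntercept x j) 2 P := fun j => by
    have h1 := h.moment (EuclideanSpace.single j 1) (by simp)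
    simp only [EuclideanSpace.inner_single_right, conj_trivial, one_mul] at h1
    have h2 : MemLp (fun x => withIntercept x j) (ENNReal.ofReal (2 + c)) P := by
      refine ⟨Measurable.aestronglyMeasurable ?_, h1.trans_lt ENNReal.ofReal_lt_top⟩
      exact (PiLp.continuous_apply 2 _ j).measurable.comp measurable_withIntercept
    refine h2.mono_exponent ?_
    rw [show (2 : ℝ≥0∞) = ENNReal.ofReal 2 by simp]
    exact ENNReal.ofReal_le_ofReal (by linarith)
  have hint : ∀ j k, Integrable (fun x => withIntercept x j * withIntercept x k) P :=
    fun j k => (hmem j).integrable_mul (hmem k)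
  have hexp : ∀ x : EuclideanSpace ℝ (Fin p), ⟪withIntercept x, v⟫ ^ 2 =
      ∑ j, ∑ k, v j * v k * (withIntercept x j * withIntercept x k) := fun x => by
    simp only [PiLp.inner_apply, RCLike.inner_apply, conj_trivial]
    rw [sq, Finset.sum_mul_sum]
    exact Finset.sum_congr rfl fun j _ => Finset.sum_congr rfl fun k _ => by ring
  calc κl * ‖v‖ ^ 2 ≤ minEigenvalue (secondMoment_isHermitian P) * ‖v‖ ^ 2 := by
        gcongr; exact h.min_eigenvalue
    _ ≤ _ := minEigenvalue_mul_norm_sq_le _ v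
    _ = _ := by
        simp only [hexp]
        rw [integral_finsetSum _ fun j _ =>
          integrable_finsetSum _ fun k _ => (hint j k).const_mul _]
        refine Finset.sum_congr rfl fun j _ => ?_
        rw [integral_finsetSum _ fun k _ => (hint j k).const_mul _]
        simp [integral_const_mul, secondMoment]

end SmallBall

/-! ### Tail bounds for counts and sums of squares -/

section Concentration

/-- A lower tail bound for the number of sample points in a set. -/
theorem measureReal_card_lt_le {Ω E : Type*} [MeasurableSpace Ω] [MeasurableSpace E]
    {μ : Measure Ω} [IsProbabilityMeasure μ] {N : ℕ} (hN : 0 < N) {X : Fin N → Ω → E}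
    (hX : ∀ i, Measurable (X i)) (hind : iIndepFun X μ) {G : Set E} (hG : MeasurableSet G)
    [DecidablePred (· ∈ G)]
    {q : ℝ} (hq : 0 ≤ q) (hqG : ∀ i, 2 * q ≤ μ.real (X i ⁻¹' G)) :
    μ.real {ω | ((Finset.univ.filter fun i => X i ω ∈ G).card : ℝ) < q * N}
      ≤ Real.exp (-(2 * q ^ 2 * N)) := by
  have hN' : (0 : ℝ) < N := by exact_mod_cast hN
  let f : E → ℝ := fun e => -G.indicator (fun _ => (1 : ℝ)) e
  have hf : Measurable f := (measurable_const.indicator hG).neg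
  have hmean : ∀ i, ∫ ω, f (X i ω) ∂μ = -μ.real (X i ⁻¹' G) := fun i => by
    have : ∀ ω, f (X i ω) = -(X i ⁻¹' G).indicator (fun _ => (1 : ℝ)) ω := fun ω => by
      simp [f, Set.indicator]
    simp only [this]
    rw [integral_neg, integral_indicator_const _ (hX i hG)]
    simp
  have hsub : ∀ i ∈ Finset.univ, HasSubgaussianMGF
      (fun ω => f (X i ω) - ∫ ω', f (X i ω') ∂μ) ((‖(0 : ℝ) - (-1)‖₊ / 2) ^ 2) μ := by
    intro i _
    refine hasSubgaussianMGF_of_mem_Icc (hf.comp (hX i)).aemeasurable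
      (Eventually.of_forall fun ω => ?_)
    by_cases h : X i ω ∈ G <;> simp [f, h]
  have hind' : iIndepFun (fun i ω => f (X i ω) - ∫ ω', f (X i ω') ∂μ) μ :=
    hind.comp (fun i e => f e - ∫ ω', f (X i ω') ∂μ) fun i => hf.sub_const _
  -- Hoeffding with deviation `q * N`, the gap between the mean count, at least `2 * q * N`, and `q
  -- * N`.
  have key := HasSubgaussianMGF.measure_sum_ge_le_of_iIndepFun hind' hsub
    (ε := q * N) (by positivity)
  refine (measureReal_mono fun ω hω => ?_).trans (key.trans (le_of_eq ?_))
  · have hsum : ∑ i, f (X i ω) = -((Finset.univ.filter fun i => X i ω ∈ G).card : ℝ) := by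
      rw [Finset.card_filter]
      simp [f, Set.indicator]
    have hlow : ∑ _i : Fin N, 2 * q ≤ ∑ i, μ.real (X i ⁻¹' G) :=
      Finset.sum_le_sum fun i _ => hqG i
    simp only [Finset.sum_const, Finset.card_univ, Fintype.card_fin, nsmul_eq_mul] at hlow
    simp only [Set.mem_ofPred_eq] at hω ⊢
    rw [Finset.sum_sub_distrib, hsum]
    simp only [hmean, Finset.sum_neg_distrib]
    linarith
  · congr 1
    simp
    field_simp

/-- Strictness supplies an admissible `t` below `s` without asking whether the infimum is attained.
-/
theorem lintegral_exp_sq_div_le_two_of_psi2Norm_lt {α : Type*} [MeasurableSpace α]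
    {P : Measure α} {f : α → ℝ} {s : ℝ} (h : psi2Norm f P < ENNReal.ofReal s) :
    ∫⁻ a, ENNReal.ofReal (Real.exp ((f a) ^ 2 / s ^ 2)) ∂P ≤ 2 := by
  unfold psi2Norm at h
  simp only [iInf_lt_iff] at h
  obtain ⟨t, ht, hint, hts⟩ := h
  refine le_trans (lintegral_mono fun a => ?_) hint
  have : t ≤ s := ((ENNReal.ofReal_lt_ofReal_iff_of_nonneg ht.le).1 hts).le
  gcongr

/-- A sum of squares of independent sub-Gaussian variables is at most linear in their number. -/
theorem measureReal_sum_sq_gt_le {Ω E : Type*} [MeasurableSpace Ω] [MeasurableSpace E]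
    {μ : Measure Ω} [IsProbabilityMeasure μ] {N : ℕ} {X : Fin N → Ω → E}
    (hX : ∀ i, Measurable (X i)) (hind : iIndepFun X μ) {P : Measure E}
    (hlaw : ∀ i, μ.map (X i) = P) {f : E → ℝ} (hf : Measurable f) {s : ℝ} (hs : 0 < s)
    (h : psi2Norm f P < ENNReal.ofReal s) (b : ℝ) :
    μ.real {ω | b * s ^ 2 * N < ∑ i, f (X i ω) ^ 2} ≤ Real.exp (-((b - 1) * N)) := by
  let g : E → ℝ := fun e => f e ^ 2 / s ^ 2
  have hg : Measurable g := (hf.pow_const 2).div_const _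
  have hlin := lintegral_exp_sq_div_le_two_of_psi2Norm_lt h
  have hlin' : ∀ i, ∫⁻ ω, ENNReal.ofReal (Real.exp (1 * g (X i ω))) ∂μ ≤ 2 := fun i => by
    rw [← hlaw i, lintegral_map (by fun_prop) (hX i)] at hlin
    simpa [g] using hlin
  have hint : ∀ i, Integrable (fun ω => Real.exp (1 * g (X i ω))) μ := fun i => by
    refine ⟨(((hg.comp (hX i)).const_mul 1).exp).aestronglyMeasurable, ?_⟩
    rw [hasFiniteIntegral_iff_ofReal (Eventually.of_forall fun ω => (Real.exp_pos _).le)]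
    exact (hlin' i).trans_lt (by simp)
  have hmgf : ∀ i, mgf (fun ω => g (X i ω)) μ 1 ≤ 2 := fun i => by
    rw [mgf, integral_eq_lintegral_of_nonneg_ae
      (Eventually.of_forall fun ω => (Real.exp_pos _).le) (hint i).1]
    exact ENNReal.toReal_le_of_le_ofReal (by norm_num) (by simpa using hlin' i)
  have hind' : iIndepFun (fun i ω => g (X i ω)) μ := hind.comp (fun _ => g) fun _ => hg
  have hmeas : ∀ i, Measurable fun ω => g (X i ω) := fun i => hg.comp (hX i)
  have key := measure_ge_le_exp_mul_mgf (μ := μ) (X := ∑ i, fun ω => g (X i ω)) (t := 1)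
    (b * N) zero_le_one (hind'.integrable_exp_mul_sum hmeas fun i _ => hint i)
  rw [hind'.mgf_sum hmeas] at key
  refine (measureReal_mono fun ω hω => ?_).trans (key.trans ?_)
  · simp only [Set.mem_ofPred_eq, Finset.sum_apply, g] at hω ⊢
    rw [← Finset.sum_div, le_div_iff₀ (by positivity)]
    linarith
  -- Each moment generating function at `1` is at most `2 ≤ exp 1`, which costs the `-1` in `b - 1`.
  · calc _ ≤ Real.exp (-1 * (b * N)) * ∏ _i : Fin N, Real.exp 1 := by
          gcongr with i
          · exact fun i _ => mgf_nonneg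
          · exact (hmgf i).trans (by linarith [Real.add_one_le_exp (1 : ℝ)])
      _ = _ := by
          rw [Finset.prod_const, ← Real.exp_nat_mul, ← Real.exp_add]
          simp
          ring

end Concentration

/-! ### Uniform band counts over an `ℓ₁` ball -/

section UniformCount

theorem exists_pos_div_rpow_le {c : ℝ} (hc : 0 < c) {C ε : ℝ} (hC : 0 < C) (hε : 0 < ε) :
    ∃ b : ℝ, 0 < b ∧ C / b ^ c ≤ ε := by
  refine ⟨(C / ε) ^ c⁻¹, by positivity, ?_⟩
  rw [Real.rpow_inv_rpow (by positivity) hc.ne', div_div_cancel₀ hC.ne']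

/-- Net points only approximate unit vectors, hence norms in `[1/2, 3/2]`. There the second moment
is at least `κl / 4`; each of the three truncations loses at most `κl / 16`, leaving `κl / 16 = β ^
2 * (2 * q)`. -/
theorem exists_small_ball_constants {κl c : ℝ} (hκl : 0 < κl) (hc : 0 < c) (M μc σ : ℝ) :
    ∃ α β T q : ℝ, 0 < α ∧ 0 < β ∧ 0 < T ∧ 0 < q ∧
      ∀ (p : ℕ) (P : Measure (EuclideanSpace ℝ (Fin p))) [IsProbabilityMeasure P]
        (γ₀ : EuclideanSpace ℝ (Fin (p + 1))), DesignConditions P γ₀ κl c M μc σ →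
        ∀ v : EuclideanSpace ℝ (Fin (p + 1)), 1 / 2 ≤ ‖v‖ → ‖v‖ ≤ 3 / 2 →
          2 * q ≤ P.real {x | |⟪withIntercept x, γ₀⟫| ≤ T ∧
            α ≤ |⟪withIntercept x, v⟫| ∧ |⟪withIntercept x, v⟫| ≤ β} := by
  have hM : (0 : ℝ) < 2 * max M 1 := by positivity
  have hμ : (0 : ℝ) < max μc 1 := by positivity
  obtain ⟨β, hβ, hβ'⟩ := exists_pos_div_rpow_le hc (C := (2 * max M 1) ^ (2 + c))
    (ε := κl / 16) (by positivity) (by positivity)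
  obtain ⟨T, hT, hT'⟩ := exists_pos_div_rpow_le hc (C := β ^ 2 * max μc 1 ^ c)
    (ε := κl / 16) (by positivity) (by positivity)
  refine ⟨√(κl / 16), β, T, κl / (32 * β ^ 2), by positivity, hβ, hT, by positivity, ?_⟩
  intro p P _ γ₀ h v hv1 hv2
  have hYM : eLpNorm (fun x => ⟪withIntercept x, v⟫) (ENNReal.ofReal (2 + c)) P
      ≤ ENNReal.ofReal (2 * max M 1) := by
    have h1 := h.moment ((1 / 2 : ℝ) • v) (by rw [norm_smul]; norm_num; linarith)
    have h2 : (fun x : EuclideanSpace ℝ (Fin p) => ⟪withIntercept x, v⟫) =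
        (2 : ℝ) • fun x => ⟪withIntercept x, (1 / 2 : ℝ) • v⟫ := by
      ext x
      simp [real_inner_smul_right]
    rw [h2, eLpNorm_const_smul, ENNReal.ofReal_mul zero_le_two]
    gcongr
    · simp [Real.enorm_eq_ofReal_abs]
    · exact h1.trans (ENNReal.ofReal_le_ofReal (le_max_left _ _))
  have hmain := le_add_sq_mul_measureReal_of_moments (a := √(κl / 16)) (β := β) (T := T)
    (measurable_inner_withIntercept v) (measurable_inner_withIntercept γ₀) hc hM.le hμ.le hβ hT
    hYM (h.moment_index.trans (ENNReal.ofReal_le_ofReal (le_max_left _ _)))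
  have hlow := h.le_integral_sq hc v
  have hv : κl * (1 / 4) ≤ κl * ‖v‖ ^ 2 := by gcongr; nlinarith
  rw [Real.sq_sqrt (by positivity)] at hmain
  rw [← mul_div_assoc (β ^ 2)] at hmain
  rw [show 2 * (κl / (32 * β ^ 2)) = κl / 16 / β ^ 2 by field_simp; norm_num,
    div_le_iff₀ (by positivity)]
  linarith

theorem norm_le_l1Norm {d : ℕ} (v : EuclideanSpace ℝ (Fin d)) : ‖v‖ ≤ l1Norm v := by
  rw [EuclideanSpace.norm_eq]
  refine Real.sqrt_le_iff.2 ⟨Finset.sum_nonneg fun j _ => abs_nonneg _, ?_⟩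
  simpa [l1Norm] using Finset.sum_sq_le_sq_sum_of_nonneg (s := Finset.univ)
    (f := fun j => |v j|) fun j _ => abs_nonneg _

/-- Counting sample points in a band is stable under small perturbations of the direction. -/
theorem exists_finset_band_of_near {d N : ℕ} (a : Fin N → EuclideanSpace ℝ (Fin d))
    {v w : EuclideanSpace ℝ (Fin d)} {α β q : ℝ} (hα : 0 < α) {s : Finset (Fin N)}
    (hs : q * N ≤ s.card) (hsw : ∀ i ∈ s, α ≤ |⟪a i, w⟫| ∧ |⟪a i, w⟫| ≤ β)
    (hnear : ∑ i, ⟪a i, w - v⟫ ^ 2 ≤ N * (q / 2 * (α / 2) ^ 2)) :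
    ∃ s' ⊆ s, q / 2 * N ≤ s'.card ∧
      ∀ i ∈ s', α / 2 ≤ |⟪a i, v⟫| ∧ |⟪a i, v⟫| ≤ β + α / 2 := by
  refine ⟨s.filter fun i => |⟪a i, w - v⟫| ≤ α / 2, Finset.filter_subset _ _, ?_, ?_⟩
  -- Markov's inequality for the empirical norm: at most `q / 2 * N` points move by more than `α /
  -- 2`.
  · set t := s.filter fun i => ¬ |⟪a i, w - v⟫| ≤ α / 2 with ht
    have h1 : (t.card : ℝ) * (α / 2) ^ 2 ≤ N * (q / 2 * (α / 2) ^ 2) := by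
      refine le_trans ?_ hnear
      rw [← nsmul_eq_mul, ← Finset.sum_const]
      refine (Finset.sum_le_sum fun i hi => ?_).trans
        (Finset.sum_le_sum_of_subset_of_nonneg (Finset.subset_univ t) fun i _ _ => sq_nonneg _)
      rw [← sq_abs ⟪a i, w - v⟫]
      have := (not_le.1 (Finset.mem_filter.1 hi).2).le
      gcongr
    have h2 : (t.card : ℝ) ≤ N * (q / 2) := by
      rw [← mul_assoc] at h1
      exact le_of_mul_le_mul_right h1 (by positivity)
    have h3 : (((s.filter fun i => |⟪a i, w - v⟫| ≤ α / 2).card + t.card : ℕ) : ℝ) = s.card := by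
      rw [ht, Finset.card_filter_add_card_filter_not]
    push_cast at h3
    linarith
  · intro i hi
    obtain ⟨hi1, hi2⟩ := Finset.mem_filter.1 hi
    obtain ⟨h1, h2⟩ := hsw i hi1
    rw [inner_sub_right] at hi2
    have h3 := abs_sub_abs_le_abs_sub ⟪a i, w⟫ ⟪a i, v⟫
    have h4 := abs_sub_abs_le_abs_sub ⟪a i, v⟫ ⟪a i, w⟫
    rw [abs_sub_comm] at h4
    constructor <;> linarith

/-- A fraction of at least `q / 2` of the sample points has a bounded index and lies in a band in
the direction `v`. -/
def ManyInBand {p N : ℕ} (x : Fin N → EuclideanSpace ℝ (Fin p))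
    (γ v : EuclideanSpace ℝ (Fin (p + 1))) (α β T q : ℝ) : Prop :=
  ∃ s : Finset (Fin N), q / 2 * N ≤ s.card ∧ ∀ i ∈ s, |⟪withIntercept (x i), γ⟫| ≤ T ∧
    α / 2 ≤ |⟪withIntercept (x i), v⟫| ∧ |⟪withIntercept (x i), v⟫| ≤ β + α / 2

/-- The event that all columns of the design are bounded by `B` in mean square and every vector of
the net of averages of `m` vertices has many sample points in its band yields many points in the
bands of all unit vectors with bounded `ℓ₁` norm. -/
theorem manyInBand_of_net {p N m : ℕ} (hN : 0 < N) (hm : 0 < m)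
    (x : Fin N → EuclideanSpace ℝ (Fin p)) (γ : EuclideanSpace ℝ (Fin (p + 1)))
    {α β T q K B : ℝ} (hα : 0 < α)
    (hB : ∀ j, ∑ i, (withIntercept (x i) j) ^ 2 ≤ B * N)
    (hK1 : K ^ 2 * (B + 1) / m ≤ 1 / 4) (hK2 : K ^ 2 * (B + 1) / m ≤ q / 2 * (α / 2) ^ 2)
    (hnet : ∀ t : Fin m → Fin (p + 1) × Bool,
      1 / 2 ≤ ‖(m : ℝ)⁻¹ • ∑ k, signedVertex K (t k)‖ →
      ‖(m : ℝ)⁻¹ • ∑ k, signedVertex K (t k)‖ ≤ 3 / 2 →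
      ∃ s : Finset (Fin N), q * N ≤ s.card ∧ ∀ i ∈ s, |⟪withIntercept (x i), γ⟫| ≤ T ∧
        α ≤ |⟪withIntercept (x i), (m : ℝ)⁻¹ • ∑ k, signedVertex K (t k)⟫| ∧
        |⟪withIntercept (x i), (m : ℝ)⁻¹ • ∑ k, signedVertex K (t k)⟫| ≤ β)
    {v : EuclideanSpace ℝ (Fin (p + 1))} (hv : ‖v‖ = 1) (hvK : l1Norm v ≤ K) :
    ManyInBand x γ v α β T q := by
  have hN' : (0 : ℝ) < N := by exact_mod_cast hN
  obtain ⟨t, ht⟩ := exists_average_signedVertex_near hm (fun i => withIntercept (x i)) hB hvK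
  set w := (m : ℝ)⁻¹ • ∑ k, signedVertex K (t k) with hw
  have hsum : 0 ≤ ∑ i, ⟪withIntercept (x i), w - v⟫ ^ 2 :=
    Finset.sum_nonneg fun i _ => sq_nonneg _
  have hwv : ‖w - v‖ ≤ 1 / 2 := by
    have : N * ‖w - v‖ ^ 2 ≤ N * (1 / 4) := by
      have := mul_le_mul_of_nonneg_left hK1 hN'.le
      linarith
    have := le_of_mul_le_mul_left this hN'
    nlinarith [norm_nonneg (w - v)]
  have h1 := norm_sub_norm_le v w
  have h2 := norm_sub_norm_le w v
  rw [norm_sub_rev] at h1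
  obtain ⟨s, hs, hsx⟩ := hnet t (by linarith) (by linarith)
  have hnear : ∑ i, ⟪withIntercept (x i), w - v⟫ ^ 2 ≤ N * (q / 2 * (α / 2) ^ 2) := by
    have := mul_le_mul_of_nonneg_left hK2 hN'.le
    have : 0 ≤ N * ‖w - v‖ ^ 2 := by positivity
    linarith
  obtain ⟨s', hs's, hs', hs'x⟩ := exists_finset_band_of_near
    (fun i => withIntercept (x i)) hα hs (fun i hi => (hsx i hi).2) hnear
  exact ⟨s', hs', fun i hi => ⟨(hsx i (hs's hi)).1, hs'x i hi⟩⟩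

theorem exists_manyInBand_constants {α q : ℝ} (hα : 0 < α) (hq : 0 < q) (σ : ℝ) :
    ∃ c₁ c₃ : ℝ, 0 < c₁ ∧ 0 < c₃ ∧ ∀ (β T : ℝ) (p N : ℕ), 0 < N →
      ∀ (Ω : Type u) [MeasurableSpace Ω] (μ : Measure Ω) [IsProbabilityMeasure μ]
        (P : Measure (EuclideanSpace ℝ (Fin p))) (γ : EuclideanSpace ℝ (Fin (p + 1)))
        (X : Fin N → Ω → EuclideanSpace ℝ (Fin p)),
        (∀ i, Measurable (X i)) → iIndepFun X μ → (∀ i, μ.map (X i) = P) →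
        (∀ j, psi2Norm (fun x => withIntercept x j) P ≤ ENNReal.ofReal σ) →
        (∀ v : EuclideanSpace ℝ (Fin (p + 1)), 1 / 2 ≤ ‖v‖ → ‖v‖ ≤ 3 / 2 →
          2 * q ≤ P.real {x | |⟪withIntercept x, γ⟫| ≤ T ∧
            α ≤ |⟪withIntercept x, v⟫| ∧ |⟪withIntercept x, v⟫| ≤ β}) →
        1 - 2 * Real.exp (-c₁ * N) ≤
          μ.real {ω | ∀ v : EuclideanSpace ℝ (Fin (p + 1)), ‖v‖ = 1 →
            c₃ * √(Real.log (p + 1) / N) * l1Norm v ≤ 1 →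
            ManyInBand (fun i => X i ω) γ v α β T q} := by
  classical
  -- With `m * L ≤ η * N` the net has at most `exp (2 * η * N) = exp (q ^ 2 * N)` points, half the
  -- Hoeffding exponent.
  set η := q ^ 2 / 2 with hη
  have hη0 : 0 < η := by positivity
  set s := |σ| + 1 with hs
  have hs0 : 0 < s := by positivity
  -- Each column fails with probability at most `exp (-(1 + η) * N)`; the `p + 1 ≤ exp (η * N)`
  -- columns together leave `exp (-N)`.
  set B := (2 + η) * s ^ 2 with hB
  have hB0 : 0 < B := by positivity
  set δ := min (1 / 4) (q / 2 * (α / 2) ^ 2) with hδ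
  have hδ0 : 0 < δ := by positivity
  set c₃ := √(2 * (B + 1) / (η * δ)) with hc₃
  have hc₃0 : 0 < c₃ := by positivity
  have hc₃sq : c₃ ^ 2 = 2 * (B + 1) / (η * δ) := Real.sq_sqrt (by positivity)
  refine ⟨min (q ^ 2) 1, c₃, by positivity, hc₃0, ?_⟩
  intro β T p N hN Ω _ μ _ P γ X hX hind hlaw hpsi hball
  have hN' : (0 : ℝ) < N := by exact_mod_cast hN
  have huniv : ∀ S : Set Ω, (∀ ω, ω ∈ S) →
      1 - 2 * Real.exp (-min (q ^ 2) 1 * N) ≤ μ.real S := fun S hS => by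
    rw [Set.eq_univ_of_forall hS, probReal_univ]
    linarith [Real.exp_pos (-min (q ^ 2) 1 * N)]
  -- For `p = 0` the logarithm vanishes and imposes no `ℓ₁` constraint, but the covariate space is a
  -- single point, so a band of positive probability contains the whole sample.
  rcases Nat.eq_zero_or_pos p with rfl | hp
  · refine huniv _ fun ω v hv _ => ⟨Finset.univ, ?_, fun i _ => ?_⟩
    · have h1 := hball v (by linarith) (by linarith)
      have : IsProbabilityMeasure P := hlaw ⟨0, hN⟩ ▸
        Measure.isProbabilityMeasure_map (hX ⟨0, hN⟩).aemeasurable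
      have h2 := measureReal_le_one (μ := P) (s := {x | |⟪withIntercept x, γ⟫| ≤ T ∧
            α ≤ |⟪withIntercept x, v⟫| ∧ |⟪withIntercept x, v⟫| ≤ β})
      simp only [Finset.card_univ, Fintype.card_fin]
      nlinarith
    · obtain ⟨y, hy⟩ := nonempty_of_measureReal_ne_zero
        (ne_of_gt (lt_of_lt_of_le (by linarith) (hball v (by linarith) (by linarith))))
      obtain rfl : y = X i ω := Subsingleton.elim _ _
      exact ⟨hy.1, by linarith [hy.2.1], by linarith [hy.2.2]⟩
  set L := Real.log (p + 1) with hL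
  have hp' : (1 : ℝ) ≤ p := by exact_mod_cast hp
  have hL0 : 0 < L := Real.log_pos (by linarith)
  have hexpL : Real.exp L = p + 1 := Real.exp_log (by linarith)
  have hrsq : √(L / N) ^ 2 = L / N := Real.sq_sqrt (by positivity)
  have hr0 : 0 < √(L / N) := by positivity
  -- If `L > η * N`, then `c₃ * √(L / N) > 1`, while unit vectors have `ℓ₁` norm at least `1`: no
  -- `v` satisfies the constraint.
  rcases lt_or_ge (η * N) L with hlarge | hsmall
  · refine huniv _ fun ω v hv hv1 => absurd hv1 (not_le.2 ?_)
    have h1 : 1 ≤ l1Norm v := hv ▸ norm_le_l1Norm v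
    have h2 : 1 < c₃ * √(L / N) := by
      rw [← one_lt_sq_iff₀ (by positivity), mul_pow, hrsq, hc₃sq]
      have h3 : η < L / N := by rwa [lt_div_iff₀ hN']
      have h4 : 1 ≤ 2 * (B + 1) / (η * δ) * η := by
        have : δ ≤ 1 / 4 := min_le_left _ _
        rw [div_mul_eq_mul_div, le_div_iff₀ (by positivity)]
        nlinarith
      refine h4.trans_lt ?_
      gcongr
    nlinarith
  set m := ⌊η * N / L⌋₊ with hm
  have hm1 : 1 ≤ m := (Nat.one_le_floor_iff _).2 ((one_le_div hL0).2 hsmall)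
  have hm1' : (1 : ℝ) ≤ m := by exact_mod_cast hm1
  have hmL : m * L ≤ η * N := (le_div_iff₀ hL0).1 (Nat.floor_le (by positivity))
  have hmlow : η * N ≤ 2 * m * L := by
    have := Nat.lt_floor_add_one (η * N / L)
    rw [← hm, div_lt_iff₀ hL0] at this
    nlinarith
  set K := (c₃ * √(L / N))⁻¹ with hK
  have hKm : K ^ 2 * (B + 1) / m ≤ δ := by
    rw [hK, inv_pow, mul_pow, hrsq, hc₃sq, div_le_iff₀ (by linarith)]
    have : (2 * (B + 1) / (η * δ) * (L / N))⁻¹ * (B + 1) = δ * (η * N / (2 * L)) := by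
      field_simp
    rw [this]
    gcongr
    rw [div_le_iff₀ (by positivity)]
    linarith
  let w : (Fin m → Fin (p + 1) × Bool) → EuclideanSpace ℝ (Fin (p + 1)) :=
    fun t => (m : ℝ)⁻¹ • ∑ k, signedVertex K (t k)
  let G : EuclideanSpace ℝ (Fin (p + 1)) → Set (EuclideanSpace ℝ (Fin p)) := fun v =>
    {x | |⟪withIntercept x, γ⟫| ≤ T ∧ α ≤ |⟪withIntercept x, v⟫| ∧ |⟪withIntercept x, v⟫| ≤ β}
  have hG : ∀ v, MeasurableSet (G v) := fun v =>
    (measurableSet_le (measurable_inner_withIntercept γ).abs measurable_const).inter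
      ((measurableSet_le measurable_const (measurable_inner_withIntercept v).abs).inter
        (measurableSet_le (measurable_inner_withIntercept v).abs measurable_const))
  let bad₁ : Fin (p + 1) → Set Ω := fun j =>
    {ω | (2 + η) * s ^ 2 * N < ∑ i, (withIntercept (X i ω) j) ^ 2}
  let bad₂ : (Fin m → Fin (p + 1) × Bool) → Set Ω := fun t =>
    {ω | (1 / 2 ≤ ‖w t‖ ∧ ‖w t‖ ≤ 3 / 2) ∧
      ((Finset.univ.filter fun i => X i ω ∈ G (w t)).card : ℝ) < q * N}
  have hbad₁ : μ.real (⋃ j, bad₁ j) ≤ Real.exp (-min (q ^ 2) 1 * N) := by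
    refine (measureReal_iUnion_fintype_le _).trans ?_
    have h1 : ∀ j, μ.real (bad₁ j) ≤ Real.exp (-((2 + η - 1) * N)) := fun j => by
      refine measureReal_sum_sq_gt_le hX hind hlaw
        ((PiLp.continuous_apply 2 _ j).measurable.comp measurable_withIntercept) hs0
        ((hpsi j).trans_lt ?_) _
      rw [ENNReal.ofReal_lt_ofReal_iff hs0]
      linarith [le_abs_self σ]
    refine (Finset.sum_le_sum fun j _ => h1 j).trans ?_
    rw [Finset.sum_const, Finset.card_univ, Fintype.card_fin, nsmul_eq_mul]
    push_cast
    rw [← hexpL, ← Real.exp_add]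
    refine Real.exp_le_exp.2 ?_
    have := mul_le_mul_of_nonneg_right (min_le_right (q ^ 2) 1) hN'.le
    linarith
  have hbad₂ : μ.real (⋃ t, bad₂ t) ≤ Real.exp (-min (q ^ 2) 1 * N) := by
    refine (measureReal_iUnion_fintype_le _).trans ?_
    have h1 : ∀ t, μ.real (bad₂ t) ≤ Real.exp (-(2 * q ^ 2 * N)) := fun t => by
      by_cases hw : 1 / 2 ≤ ‖w t‖ ∧ ‖w t‖ ≤ 3 / 2
      · have hcount := measureReal_card_lt_le (μ := μ) hN hX hind (hG (w t)) hq.le fun i => by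
          rw [← map_measureReal_apply (hX i) (hG _), hlaw i]
          exact hball _ hw.1 hw.2
        refine (measureReal_mono fun ω hω => ?_).trans hcount
        exact hω.2
      · have : bad₂ t = ∅ := Set.eq_empty_of_forall_notMem fun ω hω => hw hω.1
        rw [this, measureReal_empty]
        positivity
    refine (Finset.sum_le_sum fun t _ => h1 t).trans ?_
    have hcard : ((Fintype.card (Fin m → Fin (p + 1) × Bool) : ℕ) : ℝ) ≤
        Real.exp (2 * (m * L)) := by
      have h2 : ((p : ℝ) + 1) * 2 ≤ Real.exp (2 * L) := by
        rw [two_mul, Real.exp_add, hexpL]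
        gcongr
        linarith
      simp only [Fintype.card_fun, Fintype.card_prod, Fintype.card_fin, Fintype.card_bool]
      push_cast
      calc (((p : ℝ) + 1) * 2) ^ m ≤ Real.exp (2 * L) ^ m := by gcongr
        _ = Real.exp (2 * (m * L)) := by rw [← Real.exp_nat_mul]; ring_nf
    rw [Finset.sum_const, Finset.card_univ, nsmul_eq_mul]
    refine (mul_le_mul_of_nonneg_right hcard (Real.exp_pos _).le).trans ?_
    rw [← Real.exp_add]
    refine Real.exp_le_exp.2 ?_
    have := mul_le_mul_of_nonneg_right (min_le_left (q ^ 2) 1) hN'.le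
    have h3 : 2 * (η * N) = q ^ 2 * N := by rw [hη]; ring
    linarith
  set good := {ω | ∀ v : EuclideanSpace ℝ (Fin (p + 1)), ‖v‖ = 1 →
    c₃ * √(L / N) * l1Norm v ≤ 1 → ManyInBand (fun i => X i ω) γ v α β T q} with hgood
  -- A cover of the whole space, rather than a complement, avoids proving `good` measurable.
  have hcover : (Set.univ : Set Ω) ⊆ good ∪ ((⋃ j, bad₁ j) ∪ ⋃ t, bad₂ t) := by
    intro ω _
    by_contra hω
    simp only [Set.mem_union, Set.mem_iUnion, not_or, not_exists] at hω
    obtain ⟨hω0, hω1, hω2⟩ := hω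
    refine hω0 fun v hv hvK => manyInBand_of_net hN hm1 _ γ (K := K) (B := B) hα
      (fun j => not_lt.1 (hω1 j)) (hKm.trans (min_le_left _ _)) (hKm.trans (min_le_right _ _))
      (fun t h1 h2 => ?_) hv ?_
    · refine ⟨Finset.univ.filter fun i => X i ω ∈ G (w t), ?_, fun i hi => ?_⟩
      · by_contra hlt
        exact hω2 t ⟨⟨h1, h2⟩, not_le.1 hlt⟩
      · exact (Finset.mem_filter.1 hi).2
    · rwa [hK, ← one_div, le_div_iff₀ (by positivity), mul_comm]
  have h1 := (measureReal_mono (μ := μ) hcover).trans ((measureReal_union_le _ _).trans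
    (add_le_add_right (measureReal_union_le _ _) _))
  rw [probReal_univ] at h1
  linarith

end UniformCount

/-! ### From band counts to restricted strong convexity -/

section RestrictedStrongConvexity

theorem deltaLoss_nonneg {p N : ℕ} (x : Fin N → EuclideanSpace ℝ (Fin p)) (r : Fin N → ℝ)
    (Δ γ : EuclideanSpace ℝ (Fin (p + 1))) : 0 ≤ deltaLoss x r Δ γ := by
  rw [deltaLoss_eq_sum]
  exact mul_nonneg (by positivity) (Finset.sum_nonneg fun i _ => logisticRemainder_nonneg _ _)

theorem l1Norm_smul {d : ℕ} (a : ℝ) (v : EuclideanSpace ℝ (Fin d)) :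
    l1Norm (a • v) = |a| * l1Norm v := by
  simp [l1Norm, abs_mul, Finset.mul_sum]

/-- When the bracket is nonpositive, convexity suffices. Otherwise `τ * l1Norm Δ < ‖Δ‖`, so `Δ /
‖Δ‖` meets the `ℓ₁` constraint, and its band count is used at scale `ρ = ‖Δ‖`. -/
theorem le_deltaLoss_of_manyInBand {p N : ℕ} (hN : 0 < N) {x : Fin N → EuclideanSpace ℝ (Fin p)}
    (r : Fin N → ℝ) {γ : EuclideanSpace ℝ (Fin (p + 1))} {α β T q τ : ℝ} (hα : 0 < α)
    (hq : 0 < q)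
    (h : ∀ v : EuclideanSpace ℝ (Fin (p + 1)), ‖v‖ = 1 → τ * l1Norm v ≤ 1 →
      ManyInBand x γ v α β T q) {Δ : EuclideanSpace ℝ (Fin (p + 1))} (hΔ : ‖Δ‖ ≤ 1)
    (hτ : 0 ≤ τ) :
    Real.sigmoid (-(T + (β + α / 2))) ^ 2 / 2 * (α / 2) ^ 2 * (q / 2) * ‖Δ‖ *
      (‖Δ‖ - τ * l1Norm Δ) ≤ deltaLoss x r Δ γ := by
  set c₂ := Real.sigmoid (-(T + (β + α / 2))) ^ 2 / 2 * (α / 2) ^ 2 * (q / 2) with hc₂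
  have hc₂0 : 0 ≤ c₂ := by positivity
  rcases le_or_gt ‖Δ‖ (τ * l1Norm Δ) with hcase | hcase
  · exact (mul_nonpos_of_nonneg_of_nonpos (by positivity) (by linarith)).trans
      (deltaLoss_nonneg _ _ _ _)
  have hl : 0 ≤ l1Norm Δ := (norm_nonneg _).trans (norm_le_l1Norm Δ)
  have hpos : 0 < ‖Δ‖ := lt_of_le_of_lt (by positivity) hcase
  obtain ⟨s, hs, hsx⟩ := h (‖Δ‖⁻¹ • Δ)
    (by rw [norm_smul, norm_inv, norm_norm, inv_mul_cancel₀ hpos.ne'])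
    (by
      rw [l1Norm_smul, abs_of_pos (by positivity), mul_left_comm, inv_mul_le_one₀ hpos]
      exact hcase.le)
  have hmain := deltaLoss_smul_ge x r (‖Δ‖⁻¹ • Δ) γ (by positivity) hpos.le hΔ hN hs hsx
  rw [smul_inv_smul₀ hpos.ne'] at hmain
  refine le_trans ?_ hmain
  rw [← hc₂, mul_assoc, sq ‖Δ‖]
  gcongr
  linarith [mul_nonneg hτ hl]

theorem exists_deltaLoss_constants {κl c : ℝ} (hκl : 0 < κl) (hc : 0 < c) (M μc σ : ℝ) :
    ∃ c₁ c₂ c₃ : ℝ, 0 < c₁ ∧ 0 < c₂ ∧ 0 < c₃ ∧ ∀ (p N : ℕ), 1 ≤ N →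
      ∀ (Ω : Type u) [MeasurableSpace Ω] (μ : Measure Ω) [IsProbabilityMeasure μ]
        (P : Measure (EuclideanSpace ℝ (Fin p))) [IsProbabilityMeasure P]
        (γ₀ : EuclideanSpace ℝ (Fin (p + 1)))
        (X : Fin N → Ω → EuclideanSpace ℝ (Fin p)) (R : Fin N → Ω → ℝ),
        DesignConditions P γ₀ κl c M μc σ → IsSample μ P γ₀ X R →
        1 - 2 * Real.exp (-c₁ * N) ≤
          μ.real {ω | ∀ Δ : EuclideanSpace ℝ (Fin (p + 1)), ‖Δ‖ ≤ 1 →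
            c₂ * ‖Δ‖ * (‖Δ‖ - c₃ * √(Real.log (p + 1) / N) * l1Norm Δ) ≤
              deltaLoss (fun i => X i ω) (fun i => R i ω) Δ γ₀} := by
  obtain ⟨α, β, T, q, hα, hβ, hT, hq, hball⟩ := exists_small_ball_constants hκl hc M μc σ
  obtain ⟨c₁, c₃, hc₁, hc₃, hmain⟩ := exists_manyInBand_constants.{u} hα hq σ
  have hs := Real.sigmoid_pos (-(T + (β + α / 2)))
  refine ⟨c₁, Real.sigmoid (-(T + (β + α / 2))) ^ 2 / 2 * (α / 2) ^ 2 * (q / 2), c₃, hc₁,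
    by positivity, hc₃, fun p N hN Ω _ μ _ P _ γ₀ X R hD hS => ?_⟩
  have hind : iIndepFun X μ := hS.indep.comp (fun _ => Prod.fst) fun _ => measurable_fst
  refine (hmain β T p N hN Ω μ P γ₀ X hS.measurable_X hind hS.law_X hD.marginal_subGaussian
    (hball p P γ₀ hD)).trans (measureReal_mono fun ω hω Δ hΔ => ?_)
  exact le_deltaLoss_of_manyInBand hN _ hα hq hω hΔ (by positivity)

theorem l1Norm_le_of_mem_cone {d : ℕ} {S : Finset (Fin d)} {Δ : EuclideanSpace ℝ (Fin d)}
    (h : Δ ∈ cone S) : l1Norm Δ ≤ 4 * √S.card * ‖Δ‖ := by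
  have h1 : l1Norm Δ ≤ 4 * ∑ j ∈ S, |Δ j| := by
    rw [l1Norm, ← Finset.sum_add_sum_compl S]
    linarith [h.1]
  have h2 : ∑ j ∈ S, |Δ j| ≤ √S.card * ‖Δ‖ := by
    refine abs_le_of_sq_le_sq' ?_ (by positivity) |>.2
    rw [mul_pow, Real.sq_sqrt (by positivity), EuclideanSpace.real_norm_sq_eq]
    refine sq_sum_le_card_mul_sum_sq.trans ?_
    gcongr
    simp only [sq_abs]
    exact Finset.sum_le_sum_of_subset_of_nonneg (Finset.subset_univ S) fun j _ _ => sq_nonneg _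
  linarith

/-- Passes from `log (p + 1)` in (i) to `log p` in (ii). For `p ≥ 2`, `p + 1 ≤ p ^ 2`; for `p ≤ 1`,
where `log p = 0`, the bound on `s` leaves at most `2 * log 2`. -/
theorem mul_log_succ_le {p s : ℕ} (hs : s ≤ p + 1) :
    (s : ℝ) * Real.log (p + 1) ≤ 2 * (s * Real.log p) + 2 * Real.log 2 := by
  have hlog2 : 0 < Real.log 2 := Real.log_pos one_lt_two
  have hs' : (s : ℝ) ≤ p + 1 := by exact_mod_cast hs
  obtain rfl | rfl | hp : p = 0 ∨ p = 1 ∨ 2 ≤ p := by lia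
  · simp [hlog2.le]
  · norm_num at hs' ⊢
    gcongr
    exact_mod_cast hs'
  · have hp' : (2 : ℝ) ≤ p := by exact_mod_cast hp
    have : Real.log (p + 1) ≤ 2 * Real.log p := by
      rw [← Real.log_rpow (by linarith)]
      refine Real.log_le_log (by linarith) ?_
      norm_cast
      nlinarith
    nlinarith [mul_le_mul_of_nonneg_left this (Nat.cast_nonneg (α := ℝ) s)]

end RestrictedStrongConvexity

end BalancedLogistic

theorem mainTheorem11 (κl c M μc σ : ℝ) (hκl : 0 < κl) (hc : 0 < c) :
    ∃ c₁ c₂ c₃ κ : ℝ, 0 < c₁ ∧ 0 < c₂ ∧ 0 < c₃ ∧ 0 < κ ∧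
      (∀ (p N : ℕ), 1 ≤ N →
        ∀ (Ω : Type u) [MeasurableSpace Ω] (μ : Measure Ω) [IsProbabilityMeasure μ]
          (P : Measure (EuclideanSpace ℝ (Fin p))) [IsProbabilityMeasure P]
          (γ₀ : EuclideanSpace ℝ (Fin (p + 1)))
          (X : Fin N → Ω → EuclideanSpace ℝ (Fin p)) (R : Fin N → Ω → ℝ),
          BalancedLogistic.DesignConditions P γ₀ κl c M μc σ →
          BalancedLogistic.IsSample μ P γ₀ X R →
          1 - 2 * Real.exp (-c₁ * N) ≤
            μ.real {ω | ∀ Δ : EuclideanSpace ℝ (Fin (p + 1)), ‖Δ‖ ≤ 1 →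
              c₂ * ‖Δ‖ * (‖Δ‖ - c₃ * √(Real.log (p + 1) / N) * BalancedLogistic.l1Norm Δ) ≤
                BalancedLogistic.deltaLoss (fun i => X i ω) (fun i => R i ω) Δ γ₀}) ∧
      (∀ p s : ℕ → ℕ,
        (fun N => (s N : ℝ) * Real.log (p N)) =o[atTop] (fun N => (N : ℝ)) →
        ∀ᶠ N in atTop,
        ∀ (Ω : Type u) [MeasurableSpace Ω] (μ : Measure Ω) [IsProbabilityMeasure μ]
          (P : Measure (EuclideanSpace ℝ (Fin (p N)))) [IsProbabilityMeasure P]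
          (γ₀ : EuclideanSpace ℝ (Fin (p N + 1)))
          (X : Fin N → Ω → EuclideanSpace ℝ (Fin (p N))) (R : Fin N → Ω → ℝ),
          (BalancedLogistic.supp γ₀).card = s N →
          BalancedLogistic.DesignConditions P γ₀ κl c M μc σ →
          BalancedLogistic.IsSample μ P γ₀ X R →
          1 - 2 * Real.exp (-c₁ * N) ≤
            μ.real {ω | BalancedLogistic.RSC (fun i => X i ω) (fun i => R i ω) γ₀ κ
              (BalancedLogistic.cone (BalancedLogistic.supp γ₀))}) := by
  obtain ⟨c₁, c₂, c₃, hc₁, hc₂, hc₃, hmain⟩ :=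
    BalancedLogistic.exists_deltaLoss_constants.{u} hκl hc M μc σ
  refine ⟨c₁, c₂, c₃, c₂ / 2, hc₁, hc₂, hc₃, by positivity, hmain, fun p s hps => ?_⟩
  -- The goal is `16 * c₃ ^ 2 * s * log (p + 1) ≤ N / 4`, which makes the `ℓ₁` term at most `‖Δ‖ /
  -- 2`. By `mul_log_succ_le` it splits into two terms, each at most `N / 8`.
  have h1 := hps.bound (c := 1 / (256 * c₃ ^ 2)) (by positivity)
  have h2 : ∀ᶠ N : ℕ in atTop, 256 * c₃ ^ 2 * Real.log 2 ≤ N :=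
    tendsto_natCast_atTop_atTop.eventually_ge_atTop _
  filter_upwards [h1, h2, eventually_ge_atTop 1] with N hN1 hN2 hN Ω _ μ _ P _ γ₀ X R hs hD hS
  have hN' : (0 : ℝ) < N := by exact_mod_cast hN
  refine (hmain (p N) N hN Ω μ P γ₀ X R hD hS).trans (measureReal_mono fun ω hω Δ hΔ => ?_)
  refine le_trans ?_ (hω Δ hΔ.2)
  have hsp : s N ≤ p N + 1 := by
    rw [← hs]
    exact (Finset.card_le_univ _).trans (by simp)
  have hlog := BalancedLogistic.mul_log_succ_le hsp
  have hl1 := BalancedLogistic.l1Norm_le_of_mem_cone hΔ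
  rw [hs] at hl1
  set τ := c₃ * √(Real.log (p N + 1) / N) with hτ
  have hτs : τ * (4 * √(s N)) ≤ 1 / 2 := by
    have hlog0 : 0 ≤ Real.log ((p N : ℝ) + 1) := Real.log_nonneg (by simp)
    refine (abs_le_of_sq_le_sq' ?_ (by norm_num)).2
    rw [hτ, mul_pow, mul_pow, mul_pow, Real.sq_sqrt (by positivity), Real.sq_sqrt (by positivity),
      show c₃ ^ 2 * (Real.log (p N + 1) / N) * (4 ^ 2 * (s N : ℝ)) =
        16 * c₃ ^ 2 * (s N * Real.log (p N + 1)) / N by ring, div_le_iff₀ hN']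
    have h3 : (s N : ℝ) * Real.log (p N) ≤ 1 / (256 * c₃ ^ 2) * N := by
      have := (le_abs_self _).trans hN1
      simpa using this
    have h4 : 256 * c₃ ^ 2 * (s N * Real.log (p N)) ≤ N := by
      have := mul_le_mul_of_nonneg_left h3 (by positivity : 0 ≤ 256 * c₃ ^ 2)
      rwa [← mul_assoc (256 * c₃ ^ 2) (1 / _), mul_one_div_cancel (by positivity), one_mul] at this
    have h5 := mul_le_mul_of_nonneg_left hlog (by positivity : 0 ≤ 16 * c₃ ^ 2)
    linarith
  have h6 : τ * BalancedLogistic.l1Norm Δ ≤ 1 / 2 * ‖Δ‖ := by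
    refine (mul_le_mul_of_nonneg_left hl1 (by positivity)).trans ?_
    rw [← mul_assoc]
    gcongr
  calc c₂ / 2 * ‖Δ‖ ^ 2 = c₂ * ‖Δ‖ * (1 / 2 * ‖Δ‖) := by ring
    _ ≤ _ := by
      gcongr
      linarith
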